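/- For graphs $\Gamma$ and $B$, a $B$-decomposition of $\Gamma$ is a collection of subgraphs of $\Gamma$, each isomorphic to $B$, whose edge sets partition the edge set of $\Gamma$; an $\ell$-cycle decomposition is a $B$-decomposition in which $B$ is the cycle $C_\ell$ of length $\ell$. An $\ell$-cycle decomposition of $\Gamma$ is equitably $2$-colourable if the vertices of $\Gamma$ can be coloured with the two colours red and blue so that every cycle of the decomposition contains $\lfloor \ell/2\rfloor$ or $\lceil \ell/2\rceil$ vertices of each colour. Let $C_5[\ell]$ denote the lexicographic product of the $5$-cycle $C_5$ with the empty graph on $\ell$ vertices: its vertex set is $V(C_5)\times\{1,\dots,\ell\}$, with $(g,h)$ adjacent to $(g',h')$ if and only if $gg'\in E(C_5)$; its parts are the five sets $\{g\}\times\{1,\dots,\ell\}$ with $g\in V(C_5)$. For every odd integer $\ell\ge 7$, there is an equitably $2$-colourable $\ell$-cycle decomposition of $C_5[\ell]$, with a colouring as above in which each part has exactly $(\ell+1)/2$ red and $(\ell-1)/2$ blue vertices. (In particular, for $\ell=7$, each part has four red and three blue vertices.) -/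

import Mathlib

/-- The lexicographic product `G[H]`: vertex set `V × W`, with `(g, h)` adjacent to `(g', h')` iff
`g` is adjacent to `g'`, or `g = g'` and `h` is adjacent to `h'`. -/
def lexProduct {V W : Type*} (G : SimpleGraph V) (H : SimpleGraph W) : SimpleGraph (V × W) where
  Adj x y := G.Adj x.1 y.1 ∨ (x.1 = y.1 ∧ H.Adj x.2 y.2)
  symm := ⟨fun _ _ h => h.imp (fun h' => h'.symm) (fun h' => ⟨h'.1.symm, h'.2.symm⟩)⟩
  loopless := ⟨fun _ h => h.elim (fun h' => G.irrefl h') (fun h' => H.irrefl h'.2)⟩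

/-- The graph `G[n]`: the lexicographic product of `G` with the empty graph on `n` vertices. The
parts of `G[n]` are the sets of vertices with a given first coordinate. -/
def blowUp {V : Type*} (G : SimpleGraph V) (n : ℕ) : SimpleGraph (V × Fin n) :=
  lexProduct G (⊥ : SimpleGraph (Fin n))

theorem blowUp_adj {V : Type*} (G : SimpleGraph V) (n : ℕ) (x y : V × Fin n) :
    (blowUp G n).Adj x y ↔ G.Adj x.1 y.1 := by
  simp [blowUp, lexProduct]

/-- A set `D` of subgraphs of `Γ` is a `B`-decomposition of `Γ` if every member of `D` is isomorphic
to `B` and the edge sets of the members of `D` partition the edges of `Γ`. -/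
structure IsDecomposition {V U : Type*} (Γ : SimpleGraph V) (B : SimpleGraph U)
    (D : Set Γ.Subgraph) : Prop where
  iso : ∀ C ∈ D, Nonempty (C.coe ≃g B)
  disjoint : D.PairwiseDisjoint (fun C => C.edgeSet)
  cover : ⋃ C ∈ D, C.edgeSet = Γ.edgeSet

/-- An `ℓ`-cycle decomposition (used for `ℓ ≥ 3`, where `SimpleGraph.cycleGraph ℓ` is the cycle of
length `ℓ`). -/
def IsCycleDecomposition {V : Type*} (Γ : SimpleGraph V) (ℓ : ℕ) (D : Set Γ.Subgraph) : Prop :=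
  IsDecomposition Γ (SimpleGraph.cycleGraph ℓ) D

/-- With `c` the number of colours, the `c`-colouring `φ` of the `ℓ`-cycle decomposition `D` is
equitable if every cycle of `D` contains `⌊ℓ / c⌋` or `⌈ℓ / c⌉` vertices of each colour. -/
def IsEquitableColouring {V S : Type*} [Fintype S] {Γ : SimpleGraph V} (ℓ : ℕ)
    (D : Set Γ.Subgraph) (φ : V → S) : Prop :=
  ∀ C ∈ D, ∀ s : S,
    {v ∈ C.verts | φ v = s}.ncard = ⌊(ℓ : ℚ) / Fintype.card S⌋₊ ∨
    {v ∈ C.verts | φ v = s}.ncard = ⌈(ℓ : ℚ) / Fintype.card S⌉₊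

/-- The two colours. -/
inductive Colour
  | red
  | blue
  deriving DecidableEq

instance : Fintype Colour where
  elems := {Colour.red, Colour.blue}
  complete := by intro x; cases x <;> simp

theorem card_colour : Fintype.card Colour = 2 := rfl

/-!
Write `ℓ = 2k + 1`. All cycles are obtained from one closed walk of length `ℓ` in `C₅[ℓ]`, the *base*,
whose `i`-th vertex is `c i` in the part `p i`. For each edge of the base take the difference of the
coordinate in the later part (the parts being cyclically ordered) and the coordinate in the earlier
one, modulo `ℓ`. If every residue occurs, then the `5ℓ` translates of the base by
`(r, s) ∈ ℤ/5 × ℤ/ℓ` together use every edge of `C₅[ℓ]`, hence, as there are only `5ℓ²` edges, each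
edge once (`exists_copies_of_forall_blowUpEdge`).

Let the vertices with coordinate at most `k` be red. A translate has the required `k + 1` red vertices
if `c` is a bijection, but then the difference `0` does not occur. So `c` takes one value twice, on
two consecutive vertices, and misses one value. If the repeated value is `k` and the missing one is
`k + 1`, then only the translates with `s = 0`, which have `k + 2` red vertices, and those with
`s = k`, which have `k`, are wrong. Both are repaired by a switch: the base is such that some red vertex
on the translate by `(r, 0)` has the same two neighbours as some blue vertex on the translate by
`(r + ρ, k)`, and exchanging these two vertices only exchanges four edges among the two cycles
(`hasBalancedDecomposition_of_base`).

For `ℓ ≥ 17` the base is mostly a zigzag `m, m + g, m - 1, m + g + 1, m - 2, …` with differences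
`g, g + 1, g + 2, …`, where `g = 2` for `ℓ = 4m + 1` and `g = 3` for `ℓ = 4m + 3`. About halfway the
zigzag repeats the coordinate `k` in a neighbouring part and then skips the coordinate `k + 1`, and
with it one difference close to `ℓ / 2`; a few further vertices close the walk. For `ℓ = 11, 13, 15`
a base is given explicitly. For `ℓ = 7, 9` the switch exchanges paths with two interior vertices
instead of single vertices, and the resulting cycles are listed.
-/

open Function

/-! ### Cycle decompositions from families of closed walks -/

/-- The edges of the cycle on `Fin n` are the pairs of consecutive vertices. -/
theorem mem_edgeSet_cycleGraph_iff {n : ℕ} [NeZero n] (hn : 2 ≤ n) (e : Sym2 (Fin n)) :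
    e ∈ (SimpleGraph.cycleGraph n).edgeSet ↔ ∃ j : Fin n, s(j, j + 1) = e := by
  have h1 : ((1 : Fin n) : ℕ) = 1 := by
    rw [Fin.val_one', Nat.mod_eq_of_lt (by omega)]
  induction e using Sym2.ind with
  | _ u v =>
    rw [SimpleGraph.mem_edgeSet, SimpleGraph.cycleGraph_adj', ← h1, Fin.val_inj, Fin.val_inj,
      sub_eq_iff_eq_add, sub_eq_iff_eq_add]
    constructor
    · rintro (h | h)
      · exact ⟨v, by rw [h, add_comm, Sym2.eq_swap]⟩
      · exact ⟨u, by rw [h, add_comm]⟩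
    · rintro ⟨j, hj⟩
      rcases Sym2.eq_iff.1 hj with ⟨rfl, rfl⟩ | ⟨rfl, rfl⟩
      · exact Or.inr (add_comm _ _)
      · exact Or.inl (add_comm _ _)

theorem SimpleGraph.Copy.mem_edgeSet_toSubgraph_cycleGraph_iff {V : Type*} {Γ : SimpleGraph V}
    {n : ℕ} [NeZero n] (hn : 2 ≤ n) (f : (SimpleGraph.cycleGraph n).Copy Γ) (e : Sym2 V) :
    e ∈ f.toSubgraph.edgeSet ↔ ∃ j : Fin n, s(f j, f (j + 1)) = e := by
  rw [SimpleGraph.Subgraph.edgeSet_map, SimpleGraph.Subgraph.edgeSet_top]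
  constructor
  · rintro ⟨e', he', rfl⟩
    obtain ⟨j, rfl⟩ := (mem_edgeSet_cycleGraph_iff hn e').1 he'
    exact ⟨j, rfl⟩
  · rintro ⟨j, rfl⟩
    exact ⟨s(j, j + 1), (mem_edgeSet_cycleGraph_iff hn _).2 ⟨j, rfl⟩, rfl⟩

/-- A family of `n`-cycles in `Γ` that traverses each edge of `Γ` exactly once is a cycle
decomposition. -/
theorem isCycleDecomposition_range_toSubgraph {V ι : Type*} {Γ : SimpleGraph V} {n : ℕ} [NeZero n]
    (hn : 2 ≤ n) (f : ι → (SimpleGraph.cycleGraph n).Copy Γ)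
    (hinj : Injective fun x : ι × Fin n => s(f x.1 x.2, f x.1 (x.2 + 1)))
    (hcov : ∀ e ∈ Γ.edgeSet, ∃ x : ι × Fin n, s(f x.1 x.2, f x.1 (x.2 + 1)) = e) :
    IsCycleDecomposition Γ n (Set.range fun i => (f i).toSubgraph) where
  iso := by
    rintro _ ⟨i, rfl⟩
    exact ⟨(f i).isoToSubgraph.symm⟩
  disjoint := by
    rintro _ ⟨i, rfl⟩ _ ⟨i', rfl⟩ hne
    refine Set.disjoint_left.2 fun e he he' => hne ?_
    obtain ⟨j, hj⟩ := ((f i).mem_edgeSet_toSubgraph_cycleGraph_iff hn e).1 he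
    obtain ⟨j', hj'⟩ := ((f i').mem_edgeSet_toSubgraph_cycleGraph_iff hn e).1 he'
    have := @hinj (i, j) (i', j') (hj.trans hj'.symm)
    exact congrArg (fun i => (f i).toSubgraph) (Prod.ext_iff.1 this).1
  cover := by
    refine Set.Subset.antisymm (Set.iUnion₂_subset fun C _ => C.edgeSet_subset) fun e he => ?_
    obtain ⟨⟨i, j⟩, h⟩ := hcov e he
    exact Set.mem_iUnion₂.2 ⟨_, ⟨i, rfl⟩, ((f i).mem_edgeSet_toSubgraph_cycleGraph_iff hn e).2 ⟨j, h⟩⟩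

/-! ### The edges of `C₅[n]` -/

/-- The edge of `C₅[n]` joining the vertex `a` of the part `i` to the vertex `b` of the next part,
where `x = (i, a, b)`. -/
def blowUpEdge {n : ℕ} (x : Fin 5 × Fin n × Fin n) : Sym2 (Fin 5 × Fin n) :=
  s((x.1, x.2.1), (x.1 + 1, x.2.2))

theorem blowUpEdge_injective {n : ℕ} : Injective (blowUpEdge (n := n)) := by
  rintro ⟨i, a, b⟩ ⟨i', a', b'⟩ h
  simp only [blowUpEdge, Sym2.eq_iff, Prod.mk.injEq] at h
  rcases h with ⟨⟨rfl, rfl⟩, -, rfl⟩ | ⟨⟨h1, -⟩, h2, -⟩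
  · rfl
  · exfalso
    revert i i'
    decide

theorem range_blowUpEdge {n : ℕ} :
    Set.range (blowUpEdge (n := n)) = (blowUp (SimpleGraph.cycleGraph 5) n).edgeSet := by
  ext e
  induction e using Sym2.ind with
  | _ u v =>
    obtain ⟨i, a⟩ := u
    obtain ⟨i', a'⟩ := v
    rw [SimpleGraph.mem_edgeSet, blowUp_adj, ← SimpleGraph.mem_edgeSet,
      mem_edgeSet_cycleGraph_iff (by norm_num)]
    constructor
    · rintro ⟨⟨j, b, b'⟩, h⟩
      rcases Sym2.eq_iff.1 h with ⟨h1, h2⟩ | ⟨h1, h2⟩ <;> cases h1 <;> cases h2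
      · exact ⟨j, rfl⟩
      · exact ⟨j, Sym2.eq_swap⟩
    · rintro ⟨j, h⟩
      rcases Sym2.eq_iff.1 h with ⟨h1, h2⟩ | ⟨h1, h2⟩ <;> subst h1 <;> subst h2
      · exact ⟨(j, a, a'), rfl⟩
      · exact ⟨(j, a', a), Sym2.eq_swap⟩

/-- Since `C₅[n]` has `5n²` edges, `5n` closed walks of length `n` in it that together traverse every
edge traverse each edge exactly once. -/
theorem exists_copies_of_forall_blowUpEdge {n : ℕ} [NeZero n] (hn : 2 ≤ n)
    (f : Fin 5 × Fin n → Fin n → Fin 5 × Fin n) (hf : ∀ i, Injective (f i))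
    (hcov : ∀ x, ∃ i j, s(f i j, f i (j + 1)) = blowUpEdge x) :
    ∃ g : Fin 5 × Fin n →
        (SimpleGraph.cycleGraph n).Copy (blowUp (SimpleGraph.cycleGraph 5) n),
      (∀ i j, g i j = f i j) ∧
      IsCycleDecomposition (blowUp (SimpleGraph.cycleGraph 5) n) n
        (Set.range fun i => (g i).toSubgraph) := by
  -- `x ↦ (σ x, τ x)` is injective between sets of size `5n²`, hence a bijection from the edges to the
  -- steps of the walks.
  choose σ τ h using hcov
  have hinj : Injective fun x => (σ x, τ x) := by
    intro x y hxy
    have hxy' := Prod.ext_iff.1 hxy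
    apply blowUpEdge_injective
    rw [← h, ← h]
    simp only at hxy'
    rw [hxy'.1, hxy'.2]
  have hcard : Fintype.card (Fin 5 × Fin n × Fin n) = Fintype.card ((Fin 5 × Fin n) × Fin n) :=
    Fintype.card_congr (Equiv.prodAssoc _ _ _).symm
  have hsurj := ((Fintype.bijective_iff_injective_and_card _).2 ⟨hinj, hcard⟩).2
  have hmem : ∀ i j, s(f i j, f i (j + 1)) ∈ (blowUp (SimpleGraph.cycleGraph 5) n).edgeSet := by
    intro i j
    obtain ⟨x, hx⟩ := hsurj (i, j)
    cases hx
    rw [h, ← range_blowUpEdge]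
    exact ⟨x, rfl⟩
  have hhom : ∀ i {a b : Fin n}, (SimpleGraph.cycleGraph n).Adj a b →
      (blowUp (SimpleGraph.cycleGraph 5) n).Adj (f i a) (f i b) := by
    intro i a b hab
    obtain ⟨j, hj⟩ := (mem_edgeSet_cycleGraph_iff hn s(a, b)).1 hab
    rcases Sym2.eq_iff.1 hj with ⟨rfl, rfl⟩ | ⟨rfl, rfl⟩
    · exact hmem i _
    · exact (hmem i _).symm
  refine ⟨fun i => ⟨⟨f i, hhom i⟩, hf i⟩, fun _ _ => rfl,
    isCycleDecomposition_range_toSubgraph hn _ ?_ ?_⟩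
  · intro y y' hyy
    obtain ⟨x, rfl⟩ := hsurj y
    obtain ⟨x', rfl⟩ := hsurj y'
    rw [blowUpEdge_injective ((h x).symm.trans (Eq.trans hyy (h x')))]
  · intro e he
    rw [← range_blowUpEdge] at he
    obtain ⟨x, rfl⟩ := he
    exact ⟨(σ x, τ x), h x⟩

/-! ### Colourings, and decompositions invariant under rotating the parts -/

/-- The colouring in which the first `k + 1` vertices of each part are red. -/
def initialRed (k n : ℕ) (x : Fin 5 × Fin n) : Colour :=
  if x.2.val ≤ k then Colour.red else Colour.blue

theorem card_red_add_card_blue {ι : Type*} [Fintype ι] {k n : ℕ} (f : ι → Fin 5 × Fin n) :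
    (Finset.univ.filter fun j => initialRed k n (f j) = Colour.red).card +
      (Finset.univ.filter fun j => initialRed k n (f j) = Colour.blue).card = Fintype.card ι := by
  rw [← Finset.card_univ, ← Finset.card_filter_add_card_filter_not
    (s := Finset.univ) (fun j => initialRed k n (f j) = Colour.red)]
  congr 2
  ext j
  cases h : initialRed k n (f j) <;> simp [h]

/-- `C₅[ℓ]` has an `ℓ`-cycle decomposition with an equitable colouring in red and blue for which each
part has `(ℓ + 1) / 2` red and `(ℓ - 1) / 2` blue vertices. -/
def HasBalancedDecomposition (ℓ : ℕ) : Prop :=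
  ∃ (D : Set (blowUp (SimpleGraph.cycleGraph 5) ℓ).Subgraph) (φ : Fin 5 × Fin ℓ → Colour),
    IsCycleDecomposition (blowUp (SimpleGraph.cycleGraph 5) ℓ) ℓ D ∧
    IsEquitableColouring ℓ D φ ∧
    ∀ i : Fin 5,
      {x : Fin 5 × Fin ℓ | x.1 = i ∧ φ x = Colour.red}.ncard = (ℓ + 1) / 2 ∧
      {x : Fin 5 × Fin ℓ | x.1 = i ∧ φ x = Colour.blue}.ncard = (ℓ - 1) / 2

/-- It suffices to give `2 * k + 1` cycles `F s`, each with `k + 1` red vertices, such that for all `a`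
and `b` some cycle joins the vertex `a` of some part to the vertex `b` of the next part: the
decomposition consists of the rotations of these cycles through the five parts. -/
theorem hasBalancedDecomposition_of_rotation {k : ℕ} (hk : 1 ≤ k)
    (F : Fin (2 * k + 1) → Fin (2 * k + 1) → Fin 5 × Fin (2 * k + 1))
    (hinj : ∀ s, Injective (F s))
    (hcov : ∀ a b, ∃ s j,
      ((F s (j + 1)).1 = (F s j).1 + 1 ∧ (F s j).2 = a ∧ (F s (j + 1)).2 = b) ∨
      ((F s j).1 = (F s (j + 1)).1 + 1 ∧ (F s (j + 1)).2 = a ∧ (F s j).2 = b))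
    (hred : ∀ s, (Finset.univ.filter fun j => (F s j).2.val ≤ k).card = k + 1) :
    HasBalancedDecomposition (2 * k + 1) := by
  have h1 : ∀ i : Fin 5 × Fin (2 * k + 1), Injective fun j => ((F i.2 j).1 + i.1, (F i.2 j).2) := by
    rintro ⟨r, s⟩ j j' h
    simp only [Prod.mk.injEq, add_left_inj] at h
    exact hinj s (Prod.ext h.1 h.2)
  have h2 : ∀ x : Fin 5 × Fin (2 * k + 1) × Fin (2 * k + 1),
      ∃ (i : Fin 5 × Fin (2 * k + 1)) (j : Fin (2 * k + 1)),
        s(((F i.2 j).1 + i.1, (F i.2 j).2), ((F i.2 (j + 1)).1 + i.1, (F i.2 (j + 1)).2)) =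
          blowUpEdge x := by
    rintro ⟨i, a, b⟩
    obtain ⟨s, j, ⟨h1, rfl, rfl⟩ | ⟨h1, rfl, rfl⟩⟩ := hcov a b
    · refine ⟨(i - (F s j).1, s), j, ?_⟩
      have h2 : (F s j).1 + 1 + (i - (F s j).1) = i + 1 := by abel
      simp only [blowUpEdge, h1, h2, add_sub_cancel]
    · refine ⟨(i - (F s (j + 1)).1, s), j, ?_⟩
      have h2 : (F s (j + 1)).1 + 1 + (i - (F s (j + 1)).1) = i + 1 := by abel
      rw [Sym2.eq_swap]
      simp only [blowUpEdge, h1, h2, add_sub_cancel]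
  obtain ⟨g, hg, hD⟩ := exists_copies_of_forall_blowUpEdge (by omega) _ h1 h2
  have hr : ∀ i, (Finset.univ.filter fun j =>
      initialRed k (2 * k + 1) (g i j) = Colour.red).card = k + 1 := by
    intro i
    rw [← hred i.2]
    congr 1
    ext j
    simp [hg, initialRed]
  have hpart : ∀ i : Fin 5, (Finset.univ.filter fun a : Fin (2 * k + 1) =>
      initialRed k (2 * k + 1) (i, a) = Colour.red).card = k + 1 := by
    intro i
    have : (Finset.univ.filter fun a : Fin (2 * k + 1) =>
        initialRed k (2 * k + 1) (i, a) = Colour.red) =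
        Finset.Iic (⟨k, by omega⟩ : Fin (2 * k + 1)) := by
      ext a
      simp [initialRed, Fin.le_def]
    rw [this, Fin.card_Iic]
  have himage : ∀ (f : Fin (2 * k + 1) → Fin 5 × Fin (2 * k + 1)), Injective f → ∀ c : Colour,
      {x | x ∈ Set.range f ∧ initialRed k (2 * k + 1) x = c}.ncard =
        (Finset.univ.filter fun j => initialRed k (2 * k + 1) (f j) = c).card := by
    intro f hf c
    rw [← Finset.card_image_of_injective _ hf, ← Set.ncard_coe_finset]
    congr 1
    ext x
    simp only [Set.mem_ofPred_eq, Set.mem_range, Finset.coe_image, Finset.coe_filter,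
      Finset.mem_univ, true_and, Set.mem_image]
    constructor
    · rintro ⟨⟨j, rfl⟩, h⟩
      exact ⟨j, h, rfl⟩
    · rintro ⟨j, h, rfl⟩
      exact ⟨⟨j, rfl⟩, h⟩
  refine ⟨_, initialRed k (2 * k + 1), hD, ?_, fun i => ?_⟩
  · rintro _ ⟨i, rfl⟩ c
    have hverts : (g i).toSubgraph.verts = Set.range (g i) := by
      simp
    have hfloor : ⌊((2 * k + 1 : ℕ) : ℚ) / Fintype.card Colour⌋₊ = k := by
      rw [card_colour, Nat.floor_div_natCast, Nat.floor_natCast]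
      omega
    have hceil : ⌈((2 * k + 1 : ℕ) : ℚ) / Fintype.card Colour⌉₊ = k + 1 := by
      rw [card_colour, Nat.ceil_eq_iff (by omega)]
      push_cast
      constructor <;> linarith
    have hb := card_red_add_card_blue (k := k) (g i)
    rw [hr, Fintype.card_fin] at hb
    rw [hfloor, hceil, hverts, himage (g i) (g i).injective]
    cases c
    · exact Or.inr (hr i)
    · left
      omega
  · have hset : ∀ c, {x : Fin 5 × Fin (2 * k + 1) | x.1 = i ∧ initialRed k (2 * k + 1) x = c} =
        {x | x ∈ Set.range (fun a : Fin (2 * k + 1) => (i, a)) ∧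
          initialRed k (2 * k + 1) x = c} := by
      intro c
      ext ⟨i', a⟩
      simp [eq_comm]
    have hb := card_red_add_card_blue (k := k) (fun a : Fin (2 * k + 1) => (i, a))
    rw [hpart, Fintype.card_fin] at hb
    rw [hset, hset, himage _ (Prod.mk_right_injective i), himage _ (Prod.mk_right_injective i),
      hpart]
    omega

/-! ### Translates of a base, and the switch -/

theorem Fin.eq_add_iff_val {n : ℕ} (a b c : Fin n) :
    c = a + b ↔ c.val = a.val + b.val ∨ c.val + n = a.val + b.val := by
  rw [Fin.ext_iff, Fin.val_add_eq_ite]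
  split_ifs <;> omega

theorem Finset.sum_update_add {ι β M : Type*} [Fintype ι] [DecidableEq ι] [AddCommMonoid M]
    (g : ι → β) (a : ι) (y : β) (w : β → M) :
    ∑ i, w (update g a y i) + w (g a) = ∑ i, w (g i) + w y := by
  rw [← Finset.add_sum_erase _ _ (Finset.mem_univ a),
    ← Finset.add_sum_erase _ (fun i => w (g i)) (Finset.mem_univ a), update_self,
    Finset.sum_congr rfl fun i hi => by rw [update_of_ne (Finset.ne_of_mem_erase hi)]]
  abel

theorem Function.Injective.update_of_notMem_range {α β : Type*} [DecidableEq α] {g : α → β}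
    (hg : Injective g) (a : α) {y : β} (hy : ∀ i, g i ≠ y) : Injective (update g a y) := by
  intro i i' h
  by_cases hi : i = a <;> by_cases hi' : i' = a
  · rw [hi, hi']
  · rw [hi, update_self, update_of_ne hi'] at h
    exact absurd h.symm (hy i')
  · rw [hi', update_self, update_of_ne hi] at h
    exact absurd h (hy i)
  · rw [update_of_ne hi, update_of_ne hi'] at h
    exact hg h

/-- The indicator of the red vertices of a part. -/
def redIndicator (k : ℕ) (v : Fin (2 * k + 1)) : ℕ :=
  if v.val ≤ k then 1 else 0

theorem sum_redIndicator (k : ℕ) : ∑ v, redIndicator k v = k + 1 := by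
  have : (Finset.univ.filter fun v : Fin (2 * k + 1) => v.val ≤ k) =
      Finset.Iic (⟨k, by omega⟩ : Fin (2 * k + 1)) := by
    ext a
    simp [Fin.le_def]
  simp only [redIndicator]
  rw [← Finset.card_filter, this, Fin.card_Iic]

/-- The decomposition given by the translates of the base `i ↦ (p i, c i)`, after a switch.

* By `hdiff` every signed difference occurs.
* By `ha`, `ha'`, `hc` and `hmiss` the coordinate `k` occurs at the positions `a` and `a'`, the coordinate
  `k + 1` does not occur, and all others occur once.
* The translate by `(0, 0)` has at position `j + 1` a vertex with coordinate `0`, which is red, and the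
  translate by `(ρ, k)` has at position `t + 1` a vertex with coordinate `2 * k - 1`, which is blue. By
  `hp₁`, `hc₁`, `hp₂` and `hc₂` these have the same neighbours, in opposite order. Neither lies on the
  other translate: for the red one because `k + 1` is missing, for the blue one by `hq`. -/
theorem hasBalancedDecomposition_of_base {k : ℕ} (hk : 2 ≤ k) (p : Fin (2 * k + 1) → Fin 5)
    (c : Fin (2 * k + 1) → Fin (2 * k + 1))
    (hdiff : ∀ d, ∃ i, (p (i + 1) = p i + 1 ∧ c (i + 1) = c i + d) ∨
      (p i = p (i + 1) + 1 ∧ c i = c (i + 1) + d))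
    (a a' : Fin (2 * k + 1)) (hp : p a' ≠ p a) (ha : (c a).val = k) (ha' : (c a').val = k)
    (hc : ∀ i i', i ≠ a → i' ≠ a → c i = c i' → i = i') (hmiss : ∀ i, (c i).val ≠ k + 1)
    (ρ : Fin 5) (j t : Fin (2 * k + 1))
    (hj : (c (j + 1)).val = 0) (ht : (c (t + 1)).val + 1 = k)
    (hp₁ : p j = p (t + 1 + 1) + ρ) (hc₁ : c j = c (t + 1 + 1) + ⟨k, by omega⟩)
    (hp₂ : p (j + 1 + 1) = p t + ρ) (hc₂ : c (j + 1 + 1) = c t + ⟨k, by omega⟩)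
    (hq : ∀ i, (c i).val + 1 = 2 * k → p i ≠ p (t + 1) + ρ) :
    HasBalancedDecomposition (2 * k + 1) := by
  set κ : Fin (2 * k + 1) := ⟨k, by omega⟩ with hκ
  have hκv : κ.val = k := rfl
  have h0v : (0 : Fin (2 * k + 1)).val = 0 := rfl
  have h1v : (1 : Fin (2 * k + 1)).val = 1 := by
    rw [Fin.val_one', Nat.mod_eq_of_lt (by omega)]
  have hκ0 : κ ≠ 0 := by
    rw [Ne, Fin.ext_iff]
    omega
  have hne : ∀ i : Fin (2 * k + 1), i + 1 ≠ i := by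
    intro i h
    rw [add_eq_left, Fin.ext_iff] at h
    omega
  have hinj : Injective (fun i => (p i, c i)) := by
    intro i i' h
    simp only [Prod.mk.injEq] at h
    by_contra hii
    have haa : a' ≠ a := fun h => hp (by rw [h])
    by_cases hi : i = a
    · have : i' = a' := hc _ _ (fun h' => hii (hi.trans h'.symm)) haa
        (Fin.ext (by rw [← h.2, hi, ha, ha']))
      exact hp (by rw [← this, ← h.1, hi])
    · by_cases hi' : i' = a
      · have : i = a' := hc _ _ hi haa (Fin.ext (by rw [h.2, hi', ha, ha']))
        exact hp (by rw [← this, h.1, hi'])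
      · exact hii (hc _ _ hi hi' h.2)
  obtain ⟨κ', hκ'⟩ : ∃ κ', κ' = κ + 1 := ⟨_, rfl⟩
  have hκ1 : κ'.val = k + 1 := by
    have := (Fin.eq_add_iff_val κ 1 _).1 hκ'
    omega
  -- Replacing the repeated coordinate by the missing one makes `c` a bijection.
  have hbij : Bijective (update c a κ') := by
    rw [Fintype.bijective_iff_injective_and_card]
    refine ⟨?_, rfl⟩
    intro i i' h
    by_cases hi : i = a <;> by_cases hi' : i' = a
    · rw [hi, hi']
    · rw [hi, update_self, update_of_ne hi'] at h
      exact absurd (by rw [← h, hκ1]) (hmiss i')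
    · rw [hi', update_self, update_of_ne hi] at h
      exact absurd (by rw [h, hκ1]) (hmiss i)
    · rw [update_of_ne hi, update_of_ne hi'] at h
      exact hc _ _ hi hi' h
  -- Hence a translate has `k + 1` red vertices, up to the correction at the position `a`.
  have hcount : ∀ s, ∑ i, redIndicator k (c i + s) + redIndicator k (κ' + s) =
      k + 1 + redIndicator k (κ + s) := by
    intro s
    have hca : c a = κ := Fin.ext ha
    rw [← Finset.sum_update_add c a κ' (fun v => redIndicator k (v + s)), hca,
      ← sum_redIndicator k]
    congr 1
    exact ((Equiv.ofBijective _ hbij).trans (Equiv.addRight s)).sum_comp (redIndicator k)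
  -- The translates before the switch. Those with `s = κ` are rotated by `ρ`, so that the two cycles
  -- involved in the switch are `G 0` and `G κ`.
  let G : Fin (2 * k + 1) → Fin (2 * k + 1) → Fin 5 × Fin (2 * k + 1) :=
    fun s i => (p i + if s = κ then ρ else 0, c i + s)
  have hG : ∀ s, Injective (G s) := by
    intro s i i' h
    simp only [G, Prod.mk.injEq, add_left_inj] at h
    exact hinj (Prod.ext h.1 h.2)
  -- The cycles after the switch.
  let F : Fin (2 * k + 1) → Fin (2 * k + 1) → Fin 5 × Fin (2 * k + 1) :=
    fun s => if s = 0 then update (G 0) (j + 1) (G κ (t + 1)) else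
      if s = κ then update (G κ) (t + 1) (G 0 (j + 1)) else G s
  have hF0 : F 0 = update (G 0) (j + 1) (G κ (t + 1)) := by simp [F]
  have hFκ : F κ = update (G κ) (t + 1) (G 0 (j + 1)) := by simp [F, hκ0]
  have hFs : ∀ s, s ≠ 0 → s ≠ κ → F s = G s := fun s h h' => by simp [F, h, h']
  have hG0 : G 0 = fun i => (p i, c i) := by
    simp [G, hκ0.symm]
  have hGκ : G κ = fun i => (p i + ρ, c i + κ) := by
    simp [G]
  have hj₀ : G 0 j = G κ (t + 1 + 1) := by
    rw [hG0, hGκ]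
    exact Prod.ext hp₁ hc₁
  have hj₂ : G 0 (j + 1 + 1) = G κ t := by
    rw [hG0, hGκ]
    exact Prod.ext hp₂ hc₂
  obtain ⟨q, hqt⟩ : ∃ q, q = c (t + 1) + κ := ⟨_, rfl⟩
  have hqv : q.val + 1 = 2 * k := by
    have := (Fin.eq_add_iff_val (c (t + 1)) κ _).1 hqt
    omega
  refine hasBalancedDecomposition_of_rotation (by omega) F (fun s => ?_) (fun x y => ?_) (fun s => ?_)
  · by_cases hs0 : s = 0
    · rw [hs0, hF0]
      refine (hG 0).update_of_notMem_range _ fun i h => ?_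
      rw [hG0, hGκ] at h
      simp only [Prod.mk.injEq] at h
      exact hq i (by rw [h.2, ← hqt, hqv]) h.1
    by_cases hsκ : s = κ
    · rw [hsκ, hFκ]
      refine (hG κ).update_of_notMem_range _ fun i h => ?_
      rw [hG0, hGκ] at h
      simp only [Prod.mk.injEq] at h
      have h' := (Fin.eq_add_iff_val (c i) κ _).1 h.2.symm
      exact hmiss i (by omega)
    · rw [hFs s hs0 hsκ]
      exact hG s
  · let R : Fin 5 × Fin (2 * k + 1) → Fin 5 × Fin (2 * k + 1) → Prop := fun v w =>
      (w.1 = v.1 + 1 ∧ v.2 = x ∧ w.2 = y) ∨ (v.1 = w.1 + 1 ∧ w.2 = x ∧ v.2 = y)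
    have hR : ∀ v w, R v w → R w v := fun v w h => h.symm
    have hGR : ∃ s i, R (G s i) (G s (i + 1)) := by
      obtain ⟨i, ⟨h1, h2⟩ | ⟨h1, h2⟩⟩ := hdiff (y - x)
      · refine ⟨x - c i, i, Or.inl ⟨?_, add_sub_cancel _ _, ?_⟩⟩
        · simp only [G, h1]
          abel
        · simp only [G, h2]
          abel
      · refine ⟨x - c (i + 1), i, Or.inr ⟨?_, add_sub_cancel _ _, ?_⟩⟩
        · simp only [G, h1]
          abel
        · simp only [G, h2]
          abel
    -- The four edges at the exchanged vertices of `G` are found on the other cycle of `F`.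
    change ∃ s i, R (F s i) (F s (i + 1))
    obtain ⟨s, i, h⟩ := hGR
    by_cases hs0 : s = 0
    · subst hs0
      by_cases hi : i = j
      · subst hi
        refine ⟨κ, t + 1, hR _ _ ?_⟩
        rwa [hFκ, update_self, update_of_ne (hne _), ← hj₀]
      by_cases hi' : i = j + 1
      · subst hi'
        refine ⟨κ, t, hR _ _ ?_⟩
        rwa [hFκ, update_self, update_of_ne (hne _).symm, ← hj₂]
      refine ⟨0, i, ?_⟩
      rwa [hF0, update_of_ne hi', update_of_ne fun h => hi (add_right_cancel h)]
    by_cases hsκ : s = κ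
    · subst hsκ
      by_cases hi : i = t
      · subst hi
        refine ⟨0, j + 1, hR _ _ ?_⟩
        rwa [hF0, update_self, update_of_ne (hne _), hj₂]
      by_cases hi' : i = t + 1
      · subst hi'
        refine ⟨0, j, hR _ _ ?_⟩
        rwa [hF0, update_self, update_of_ne (hne _).symm, hj₀]
      refine ⟨κ, i, ?_⟩
      rwa [hFκ, update_of_ne hi', update_of_ne fun h => hi (add_right_cancel h)]
    · exact ⟨s, i, by rwa [hFs s hs0 hsκ]⟩
  · rw [Finset.card_filter]
    change ∑ i, redIndicator k (F s i).2 = k + 1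
    have hGs : ∑ i, redIndicator k (G s i).2 + redIndicator k (κ' + s) =
      k + 1 + redIndicator k (κ + s) := hcount s
    obtain ⟨x, hx⟩ : ∃ x, x = κ' + s := ⟨_, rfl⟩
    obtain ⟨y, hy⟩ : ∃ y, y = κ + s := ⟨_, rfl⟩
    have ex := (Fin.eq_add_iff_val _ _ _).1 hx
    have ey := (Fin.eq_add_iff_val _ _ _).1 hy
    have hred : redIndicator k (G 0 (j + 1)).2 = 1 := if_pos (by simp only [hG0]; omega)
    have hblue : redIndicator k (G κ (t + 1)).2 = 0 :=
      if_neg (by simp only [hGκ]; rw [← hqt]; omega)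
    rw [← hx, ← hy] at hGs
    by_cases hs0 : s = 0
    · subst hs0
      have h := Finset.sum_update_add (G 0) (j + 1) (G κ (t + 1)) fun v => redIndicator k v.2
      rw [← hF0] at h
      have hxw : redIndicator k x = 0 := if_neg (by omega)
      have hyw : redIndicator k y = 1 := if_pos (by omega)
      omega
    by_cases hsκ : s = κ
    · subst hsκ
      have h := Finset.sum_update_add (G κ) (t + 1) (G 0 (j + 1)) fun v => redIndicator k v.2
      rw [← hFκ] at h
      have hxw : redIndicator k x = 1 := if_pos (by omega)
      have hyw : redIndicator k y = 0 := if_neg (by omega)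
      omega
    · rw [hFs s hs0 hsκ]
      have h1 : s.val ≠ 0 := fun h => hs0 (Fin.ext h)
      have h2 : s.val ≠ k := fun h => hsκ (Fin.ext h)
      have hxy : redIndicator k x = redIndicator k y := by
        unfold redIndicator
        split_ifs <;> omega
      omega

/-- A version of `hasBalancedDecomposition_of_base` in which positions, parts and coordinates are natural
numbers, the position `2 * k + 1` is identified with `0`, and each congruence `x ≡ y + z` between
residues is spelled out as `x = y + z` or `x + modulus = y + z`. -/
theorem hasBalancedDecomposition_of_nat_base {k : ℕ} (hk : 2 ≤ k) (p c : ℕ → ℕ)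
    (hp5 : ∀ n, p n < 5) (hcl : ∀ n, c n < 2 * k + 1)
    (hp0 : p (2 * k + 1) = p 0) (hc0 : c (2 * k + 1) = c 0)
    (hdiff : ∀ d < 2 * k + 1, ∃ n < 2 * k + 1,
      ((p (n + 1) = p n + 1 ∨ p (n + 1) + 5 = p n + 1) ∧
        (c (n + 1) = c n + d ∨ c (n + 1) + (2 * k + 1) = c n + d)) ∨
      ((p n = p (n + 1) + 1 ∨ p n + 5 = p (n + 1) + 1) ∧
        (c n = c (n + 1) + d ∨ c n + (2 * k + 1) = c (n + 1) + d)))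
    (a a' : ℕ) (hal : a < 2 * k + 1) (hal' : a' < 2 * k + 1)
    (hp : p a' ≠ p a) (ha : c a = k) (ha' : c a' = k)
    (hc : ∀ n n', n < 2 * k + 1 → n' < 2 * k + 1 → n ≠ a → n' ≠ a → c n = c n' → n = n')
    (hmiss : ∀ n, n < 2 * k + 1 → c n ≠ k + 1)
    (ρ j t : ℕ) (hρ : ρ < 5) (hjl : j + 2 < 2 * k + 1) (htl : t + 2 < 2 * k + 1)
    (hj : c (j + 1) = 0) (ht : c (t + 1) + 1 = k)
    (hp₁ : p j = p (t + 2) + ρ ∨ p j + 5 = p (t + 2) + ρ)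
    (hc₁ : c j = c (t + 2) + k ∨ c j + (2 * k + 1) = c (t + 2) + k)
    (hp₂ : p (j + 2) = p t + ρ ∨ p (j + 2) + 5 = p t + ρ)
    (hc₂ : c (j + 2) = c t + k ∨ c (j + 2) + (2 * k + 1) = c t + k)
    (hq : ∀ n, n < 2 * k + 1 → c n + 1 = 2 * k →
      p n ≠ p (t + 1) + ρ ∧ p n + 5 ≠ p (t + 1) + ρ) :
    HasBalancedDecomposition (2 * k + 1) := by
  have hval1 : ∀ (n : ℕ) (h : n + 1 < 2 * k + 1),
      (⟨n, by omega⟩ : Fin (2 * k + 1)) + 1 = ⟨n + 1, h⟩ := fun n h => by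
    have h1 : (1 : Fin (2 * k + 1)).val = 1 := by
      rw [Fin.val_one', Nat.mod_eq_of_lt (by omega)]
    exact ((Fin.eq_add_iff_val _ _ _).2 (Or.inl (by rw [h1]))).symm
  have hsucc : ∀ (n : ℕ) (h : n < 2 * k + 1) (f : ℕ → ℕ), f (2 * k + 1) = f 0 →
      f ((⟨n, h⟩ : Fin (2 * k + 1)) + 1).val = f (n + 1) := by
    intro n h f hf
    by_cases hn : n + 1 < 2 * k + 1
    · rw [hval1 n hn]
    · obtain rfl : n = 2 * k := by omega
      have h1 : (1 : Fin (2 * k + 1)).val = 1 := by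
        rw [Fin.val_one', Nat.mod_eq_of_lt (by omega)]
      rw [hf]
      congr 1
      rw [Fin.val_add, h1]
      exact Nat.mod_self _
  refine hasBalancedDecomposition_of_base hk (fun i => ⟨p i, hp5 _⟩) (fun i => ⟨c i, hcl _⟩) ?_
    ⟨a, hal⟩ ⟨a', hal'⟩ (fun h => hp (Fin.ext_iff.1 h)) ha ha' ?_ (fun i => hmiss i i.2) ⟨ρ, hρ⟩
    ⟨j, by omega⟩ ⟨t, by omega⟩ ?_ ?_ ?_ ?_ ?_ ?_ ?_
  · intro d
    obtain ⟨n, hn, h⟩ := hdiff d d.2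
    refine ⟨⟨n, hn⟩, ?_⟩
    simp only [Fin.eq_add_iff_val, hsucc n hn p hp0, hsucc n hn c hc0]
    exact h
  · intro i i' hi hi' h
    exact Fin.ext (hc i i' i.2 i'.2 (fun h => hi (Fin.ext h)) (fun h => hi' (Fin.ext h))
      (Fin.ext_iff.1 h))
  · rw [hval1 _ (by omega)]
    exact hj
  · rw [hval1 _ (by omega)]
    exact ht
  · simp only [hval1 t (by omega), hval1 (t + 1) (by omega), Fin.eq_add_iff_val]
    exact hp₁
  · simp only [hval1 t (by omega), hval1 (t + 1) (by omega), Fin.eq_add_iff_val]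
    exact hc₁
  · simp only [hval1 j (by omega), hval1 (j + 1) (by omega), Fin.eq_add_iff_val]
    exact hp₂
  · simp only [hval1 j (by omega), hval1 (j + 1) (by omega), Fin.eq_add_iff_val]
    exact hc₂
  · intro i hi h
    rw [hval1 _ (by omega), Fin.eq_add_iff_val] at h
    exact h.elim (hq i i.2 hi).1 (hq i i.2 hi).2

/-! ### The base for `ℓ = 4m + 1` -/

/-- The coordinates of the base for `ℓ = 4m + 1`, as representatives in `[0, ℓ)`. The zigzag occupies the
positions up to `4m - 2`: a descending sequence starting from `m` and an ascending one starting from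
`m + 2`, which change places at the position `2m - 2`, where the value `2m` is repeated. All positions
after `4m` have the value of the position `0`. -/
def coord₁ (m n : ℕ) : ℕ :=
  if n = 2 * m - 2 then 2 * m
  else if n < 2 * m - 2 then (if n % 2 = 0 then m - n / 2 else m + 2 + n / 2)
  else if n ≤ 4 * m - 2 then
    (if n % 2 = 0 then m + 2 + n / 2 else if n ≤ 2 * m + 1 then m - n / 2 else 5 * m + 1 - n / 2)
  else if n = 4 * m - 1 then 3 * m + 2
  else if n = 4 * m then m + 1
  else m

/-- The parts of the base for `ℓ = 4m + 1`. The zigzag runs between the parts `0` and `1`, and after the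
position `2m - 2` between the parts `1` and `2`. -/
def part₁ (m n : ℕ) : ℕ :=
  if n < 2 * m - 2 then n % 2
  else if n ≤ 4 * m - 2 then 2 - n % 2
  else if n = 4 * m - 1 then 3
  else if n = 4 * m then 4
  else 0

set_option linter.unusedSimpArgs false in
/-- Every residue `d` is a signed difference of the base. -/
theorem exists_signed_difference₁ {m : ℕ} (hm : 4 ≤ m) (d : ℕ) (hd : d < 4 * m + 1) :
    ∃ n < 4 * m + 1,
      ((part₁ m (n + 1) = part₁ m n + 1 ∨ part₁ m (n + 1) + 5 = part₁ m n + 1) ∧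
        (coord₁ m (n + 1) = coord₁ m n + d ∨
          coord₁ m (n + 1) + (4 * m + 1) = coord₁ m n + d)) ∨
      ((part₁ m n = part₁ m (n + 1) + 1 ∨ part₁ m n + 5 = part₁ m (n + 1) + 1) ∧
        (coord₁ m n = coord₁ m (n + 1) + d ∨
          coord₁ m n + (4 * m + 1) = coord₁ m (n + 1) + d)) := by
  rcases Nat.eq_zero_or_pos d with rfl | h0
  · refine ⟨2 * m - 3, by omega, ?_⟩
    simp (disch := omega) only [coord₁, part₁, if_pos, if_neg, if_true, if_false, true_or,
      or_true, true_and, and_true, false_or, or_false, false_and, and_false]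
    omega
  rcases Nat.lt_or_ge d 2 with h1 | h1
  · obtain rfl : d = 1 := by omega
    refine ⟨4 * m - 2, by omega, ?_⟩
    simp (disch := omega) only [coord₁, part₁, if_pos, if_neg, if_true, if_false, true_or,
      or_true, true_and, and_true, false_or, or_false, false_and, and_false]
    omega
  obtain ⟨n, rfl⟩ : ∃ n, d = n + 2 := ⟨d - 2, by omega⟩
  rcases Nat.lt_or_ge n (2 * m - 3) with h2 | h2
  · refine ⟨n, by omega, ?_⟩
    rcases Nat.mod_two_eq_zero_or_one n with h | h <;>
    · simp (disch := omega) only [coord₁, part₁, if_pos, if_neg, if_true, if_false, true_or,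
        or_true, true_and, and_true, false_or, or_false, false_and, and_false]
      omega
  rcases Nat.lt_or_ge n (2 * m - 2) with h3 | h3
  · refine ⟨2 * m - 2, by omega, ?_⟩
    simp (disch := omega) only [coord₁, part₁, if_pos, if_neg, if_true, if_false, true_or,
      or_true, true_and, and_true, false_or, or_false, false_and, and_false]
    omega
  rcases Nat.lt_or_ge n (2 * m - 1) with h4 | h4
  · refine ⟨4 * m - 1, by omega, ?_⟩
    simp (disch := omega) only [coord₁, part₁, if_pos, if_neg, if_true, if_false, true_or,
      or_true, true_and, and_true, false_or, or_false, false_and, and_false]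
    omega
  rcases Nat.lt_or_ge n (4 * m - 2) with h5 | h5
  · refine ⟨n, by omega, ?_⟩
    rcases Nat.mod_two_eq_zero_or_one n with h | h
    · rcases Nat.lt_or_ge n (2 * m + 1) with h6 | h6 <;>
      · simp (disch := omega) only [coord₁, part₁, if_pos, if_neg, if_true, if_false, true_or,
          or_true, true_and, and_true, false_or, or_false, false_and, and_false]
        omega
    · rcases Nat.lt_or_ge n (2 * m + 2) with h6 | h6 <;>
      · simp (disch := omega) only [coord₁, part₁, if_pos, if_neg, if_true, if_false, true_or,
          or_true, true_and, and_true, false_or, or_false, false_and, and_false]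
        omega
  · refine ⟨4 * m, by omega, ?_⟩
    simp (disch := omega) only [coord₁, part₁, if_pos, if_neg, if_true, if_false, true_or,
      or_true, true_and, and_true, false_or, or_false, false_and, and_false]
    omega

theorem coord₁_injOn {m n n' : ℕ} (hm : 4 ≤ m) (hn : n < 4 * m + 1) (hn' : n' < 4 * m + 1)
    (h0 : n ≠ 2 * m - 2) (h0' : n' ≠ 2 * m - 2) (h : coord₁ m n = coord₁ m n') : n = n' := by
  unfold coord₁ at h
  split_ifs at h <;> omega

theorem hasBalancedDecomposition_four_mul_add_one {m : ℕ} (hm : 4 ≤ m) :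
    HasBalancedDecomposition (2 * (2 * m) + 1) := by
  -- The repeated coordinate is at `2m - 3` and `2m - 2`; the switch exchanges the vertices at the
  -- positions `2m + 1` and `2m - 5`, where the zigzag has its coordinates `0` and `k - 1`.
  refine hasBalancedDecomposition_of_nat_base (by omega) (part₁ m) (coord₁ m)
    ?_ ?_ ?_ ?_ ?_ (2 * m - 2) (2 * m - 3) (by omega) (by omega) ?_ ?_ ?_ ?_ ?_
    2 (2 * m) (2 * m - 6) (by omega) (by omega) (by omega) ?_ ?_ ?_ ?_ ?_ ?_ ?_
  · intro n
    unfold part₁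
    split_ifs <;> omega
  · intro n
    unfold coord₁
    split_ifs <;> omega
  · simp (disch := omega) only [part₁, if_pos, if_neg]
  · simp (disch := omega) only [coord₁, if_pos, if_neg, if_true]
    omega
  · intro d hd
    rw [← mul_assoc] at hd ⊢
    exact exists_signed_difference₁ hm d hd
  · simp (disch := omega) only [part₁, if_pos, if_neg]
    omega
  · simp (disch := omega) only [coord₁, if_pos, if_neg, if_true]
  · simp (disch := omega) only [coord₁, if_pos, if_neg]
    omega
  · intro n n' hn hn' hna hna' h
    exact coord₁_injOn hm (by omega) (by omega) hna hna' h
  · intro n hn h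
    unfold coord₁ at h
    split_ifs at h <;> omega
  · simp (disch := omega) only [coord₁, if_pos, if_neg]
    omega
  · simp (disch := omega) only [coord₁, if_pos, if_neg]
    omega
  · simp (disch := omega) only [part₁, if_pos, if_neg]
    omega
  · simp (disch := omega) only [coord₁, if_pos, if_neg]
    omega
  · simp (disch := omega) only [part₁, if_pos, if_neg]
    omega
  · simp (disch := omega) only [coord₁, if_pos, if_neg]
    omega
  · intro n hn h
    -- The only vertex with coordinate `2k - 1` is in the zigzag, at the position `2m + 5`.
    obtain rfl : n = 2 * m + 5 := by
      unfold coord₁ at h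
      split_ifs at h <;> omega
    simp (disch := omega) only [part₁, if_pos, if_neg]
    omega

/-! ### The base for `ℓ = 4m + 3` -/

/-- The coordinates of the base for `ℓ = 4m + 3`, as representatives in `[0, ℓ)`. The zigzag occupies the
positions up to `4m - 2`: a descending sequence starting from `m` and an ascending one starting from
`m + 3`, which change places at the position `2m - 2`, where the value `2m + 1` is repeated. All
positions after `4m + 2` have the value of the position `0`. -/
def coord₃ (m n : ℕ) : ℕ :=
  if n = 2 * m - 2 then 2 * m + 1
  else if n < 2 * m - 2 then (if n % 2 = 0 then m - n / 2 else m + 3 + n / 2)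
  else if n ≤ 4 * m - 2 then
    (if n % 2 = 0 then m + 3 + n / 2 else if n ≤ 2 * m + 1 then m - n / 2 else 5 * m + 3 - n / 2)
  else if n = 4 * m - 1 then 3 * m + 4
  else if n = 4 * m then 3 * m + 3
  else if n = 4 * m + 1 then m + 1
  else if n = 4 * m + 2 then m + 2
  else m

/-- The parts of the base for `ℓ = 4m + 3`. The zigzag runs between the parts `0` and `1`, and after the
position `2m - 2` between the parts `4` and `0`. -/
def part₃ (m n : ℕ) : ℕ :=
  if n < 2 * m - 2 then n % 2
  else if n ≤ 4 * m - 2 then (if n % 2 = 0 then 0 else 4)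
  else if n = 4 * m - 1 then 1
  else if n = 4 * m then 2
  else if n = 4 * m + 1 then 3
  else if n = 4 * m + 2 then 4
  else 0

set_option linter.unusedSimpArgs false in
/-- Every residue `d` is a signed difference of the base. -/
theorem exists_signed_difference₃ {m : ℕ} (hm : 4 ≤ m) (d : ℕ) (hd : d < 4 * m + 3) :
    ∃ n < 4 * m + 3,
      ((part₃ m (n + 1) = part₃ m n + 1 ∨ part₃ m (n + 1) + 5 = part₃ m n + 1) ∧
        (coord₃ m (n + 1) = coord₃ m n + d ∨
          coord₃ m (n + 1) + (4 * m + 3) = coord₃ m n + d)) ∨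
      ((part₃ m n = part₃ m (n + 1) + 1 ∨ part₃ m n + 5 = part₃ m (n + 1) + 1) ∧
        (coord₃ m n = coord₃ m (n + 1) + d ∨
          coord₃ m n + (4 * m + 3) = coord₃ m (n + 1) + d)) := by
  rcases Nat.lt_or_ge d 3 with h0 | h0
  · interval_cases d
    · refine ⟨2 * m - 3, by omega, ?_⟩
      simp (disch := omega) only [coord₃, part₃, if_pos, if_neg, if_true, if_false, true_or,
        or_true, true_and, and_true, false_or, or_false, false_and, and_false]
      omega
    · refine ⟨4 * m + 1, by omega, ?_⟩
      simp (disch := omega) only [coord₃, part₃, if_pos, if_neg, if_true, if_false, true_or,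
        or_true, true_and, and_true, false_or, or_false, false_and, and_false]
    · refine ⟨4 * m - 2, by omega, ?_⟩
      simp (disch := omega) only [coord₃, part₃, if_pos, if_neg, if_true, if_false, true_or,
        or_true, true_and, and_true, false_or, or_false, false_and, and_false]
      omega
  obtain ⟨n, rfl⟩ : ∃ n, d = n + 3 := ⟨d - 3, by omega⟩
  rcases Nat.lt_or_ge n (2 * m - 3) with h1 | h1
  · refine ⟨n, by omega, ?_⟩
    rcases Nat.mod_two_eq_zero_or_one n with h | h <;>
    · simp (disch := omega) only [coord₃, part₃, if_pos, if_neg, if_true, if_false, true_or,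
        or_true, true_and, and_true, false_or, or_false, false_and, and_false]
      omega
  rcases Nat.lt_or_ge n (2 * m - 2) with h2 | h2
  · refine ⟨2 * m - 2, by omega, ?_⟩
    simp (disch := omega) only [coord₃, part₃, if_pos, if_neg, if_true, if_false, true_or,
      or_true, true_and, and_true, false_or, or_false, false_and, and_false]
    omega
  rcases Nat.lt_or_ge n (2 * m - 1) with h3 | h3
  · refine ⟨4 * m, by omega, ?_⟩
    simp (disch := omega) only [coord₃, part₃, if_pos, if_neg, if_true, if_false, true_or,
      or_true, true_and, and_true, false_or, or_false, false_and, and_false]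
    omega
  rcases Nat.lt_or_ge n (4 * m - 2) with h4 | h4
  · refine ⟨n, by omega, ?_⟩
    rcases Nat.mod_two_eq_zero_or_one n with h | h
    · rcases Nat.lt_or_ge n (2 * m + 1) with h5 | h5 <;>
      · simp (disch := omega) only [coord₃, part₃, if_pos, if_neg, if_true, if_false, true_or,
          or_true, true_and, and_true, false_or, or_false, false_and, and_false]
        omega
    · rcases Nat.lt_or_ge n (2 * m + 2) with h5 | h5 <;>
      · simp (disch := omega) only [coord₃, part₃, if_pos, if_neg, if_true, if_false, true_or,
          or_true, true_and, and_true, false_or, or_false, false_and, and_false]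
        omega
  rcases Nat.lt_or_ge n (4 * m - 1) with h5 | h5
  · refine ⟨4 * m + 2, by omega, ?_⟩
    simp (disch := omega) only [coord₃, part₃, if_pos, if_neg, if_true, if_false, true_or,
      or_true, true_and, and_true, false_or, or_false, false_and, and_false]
    omega
  · refine ⟨4 * m - 1, by omega, ?_⟩
    simp (disch := omega) only [coord₃, part₃, if_pos, if_neg, if_true, if_false, true_or,
      or_true, true_and, and_true, false_or, or_false, false_and, and_false]
    omega

set_option maxHeartbeats 1000000 in
theorem coord₃_injOn {m n n' : ℕ} (hm : 4 ≤ m) (hn : n < 4 * m + 3) (hn' : n' < 4 * m + 3)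
    (h0 : n ≠ 2 * m - 2) (h0' : n' ≠ 2 * m - 2) (h : coord₃ m n = coord₃ m n') : n = n' := by
  unfold coord₃ at h
  split_ifs at h <;> omega

theorem hasBalancedDecomposition_four_mul_add_three {m : ℕ} (hm : 4 ≤ m) :
    HasBalancedDecomposition (2 * (2 * m + 1) + 1) := by
  have hl : 2 * (2 * m + 1) + 1 = 4 * m + 3 := by ring
  -- The repeated coordinate is at `2m - 3` and `2m - 2`; the switch exchanges the vertices at the
  -- positions `2m + 1` and `2m - 5`, where the zigzag has its coordinates `0` and `k - 1`.
  refine hasBalancedDecomposition_of_nat_base (by omega) (part₃ m) (coord₃ m)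
    ?_ ?_ ?_ ?_ ?_ (2 * m - 2) (2 * m - 3) (by omega) (by omega) ?_ ?_ ?_ ?_ ?_
    0 (2 * m) (2 * m - 6) (by omega) (by omega) (by omega) ?_ ?_ ?_ ?_ ?_ ?_ ?_
  · intro n
    unfold part₃
    split_ifs <;> omega
  · intro n
    unfold coord₃
    split_ifs <;> omega
  · simp (disch := omega) only [part₃, if_pos, if_neg]
  · simp (disch := omega) only [coord₃, if_pos, if_neg, if_true]
    omega
  · intro d hd
    rw [hl] at hd ⊢
    exact exists_signed_difference₃ hm d hd
  · simp (disch := omega) only [part₃, if_pos, if_neg]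
    omega
  · simp (disch := omega) only [coord₃, if_pos, if_neg, if_true]
  · simp (disch := omega) only [coord₃, if_pos, if_neg]
    omega
  · intro n n' hn hn' hna hna' h
    exact coord₃_injOn hm (by omega) (by omega) hna hna' h
  · intro n hn h
    unfold coord₃ at h
    split_ifs at h <;> omega
  · simp (disch := omega) only [coord₃, if_pos, if_neg]
    omega
  · simp (disch := omega) only [coord₃, if_pos, if_neg]
    omega
  · simp (disch := omega) only [part₃, if_pos, if_neg]
    omega
  · simp (disch := omega) only [coord₃, if_pos, if_neg]
    omega
  · simp (disch := omega) only [part₃, if_pos, if_neg]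
    omega
  · simp (disch := omega) only [coord₃, if_pos, if_neg]
    omega
  · intro n hn h
    -- The only vertex with coordinate `2k - 1` is in the zigzag, at the position `2m + 5`.
    obtain rfl : n = 2 * m + 5 := by
      unfold coord₃ at h
      split_ifs at h <;> omega
    simp (disch := omega) only [part₃, if_pos, if_neg]
    omega

/-! ### Short cycles -/

/-- The cycles with `s ≠ 0, 3` are translates of one base; for `s = 0` and `s = 3` paths with two interior
vertices have been exchanged between the translates. -/
theorem hasBalancedDecomposition_seven : HasBalancedDecomposition 7 := by
  refine hasBalancedDecomposition_of_rotation (k := 3) (by norm_num)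
    (fun s => if s = 0 then ![(0, 3), (1, 3), (0, 5), (4, 1), (3, 2), (2, 5), (1, 6)]
      else if s = 3 then ![(2, 6), (3, 6), (2, 4), (1, 3), (0, 1), (4, 0), (3, 2)]
      else fun i => (![0, 1, 0, 4, 3, 2, 1] i, ![3, 3, 1, 0, 2, 5, 6] i + s)) ?_ ?_ ?_
  · unfold Injective
    decide
  · decide
  · decide

/-- As for seven, with the exchange between the cycles `s = 0` and `s = 4`. -/
theorem hasBalancedDecomposition_nine : HasBalancedDecomposition 9 := by
  refine hasBalancedDecomposition_of_rotation (k := 4) (by norm_num)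
    (fun s => if s = 0 then
        ![(0, 4), (1, 4), (2, 6), (3, 0), (4, 1), (0, 8), (4, 2), (0, 6), (4, 7)]
      else if s = 4 then
        ![(0, 8), (1, 8), (2, 1), (3, 4), (4, 5), (0, 3), (4, 7), (0, 2), (4, 3)]
      else fun i => (![0, 1, 2, 3, 4, 0, 4, 0, 4] i, ![4, 4, 6, 0, 1, 8, 3, 2, 7] i + s)) ?_ ?_ ?_
  · unfold Injective
    decide
  · decide
  · decide

theorem hasBalancedDecomposition_eleven : HasBalancedDecomposition 11 :=
  hasBalancedDecomposition_of_base (k := 5) (by norm_num) ![0, 1, 0, 1, 2, 3, 2, 3, 2, 3, 4]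
    ![5, 5, 4, 9, 2, 8, 1, 3, 0, 10, 7] (by decide) 0 1 (by decide) rfl rfl (by decide) (by decide)
    2 7 1 rfl rfl rfl rfl rfl rfl (by decide)

theorem hasBalancedDecomposition_thirteen : HasBalancedDecomposition 13 :=
  hasBalancedDecomposition_of_base (k := 6) (by norm_num)
    ![0, 1, 0, 4, 0, 1, 2, 3, 4, 3, 4, 3, 4] ![6, 6, 5, 3, 9, 0, 12, 10, 2, 8, 4, 1, 11]
    (by decide) 0 1 (by decide) rfl rfl (by decide) (by decide)
    1 4 1 rfl rfl rfl rfl rfl rfl (by decide)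

theorem hasBalancedDecomposition_fifteen : HasBalancedDecomposition 15 :=
  hasBalancedDecomposition_of_base (k := 7) (by norm_num)
    ![0, 1, 0, 1, 0, 1, 0, 1, 2, 3, 2, 3, 4, 3, 4]
    ![13, 14, 12, 0, 10, 1, 9, 4, 2, 11, 7, 7, 3, 6, 5]
    (by decide) 10 11 (by decide) rfl rfl (by decide) (by decide)
    1 2 12 rfl rfl rfl rfl rfl rfl (by decide)

/-! ### All lengths -/

theorem mainTheorem6 (ℓ : ℕ) (hodd : Odd ℓ) (hℓ : 7 ≤ ℓ) :
    ∃ (D : Set (blowUp (SimpleGraph.cycleGraph 5) ℓ).Subgraph) (φ : Fin 5 × Fin ℓ → Colour),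
      IsCycleDecomposition (blowUp (SimpleGraph.cycleGraph 5) ℓ) ℓ D ∧
      IsEquitableColouring ℓ D φ ∧
      ∀ i : Fin 5,
        {x : Fin 5 × Fin ℓ | x.1 = i ∧ φ x = Colour.red}.ncard = (ℓ + 1) / 2 ∧
        {x : Fin 5 × Fin ℓ | x.1 = i ∧ φ x = Colour.blue}.ncard = (ℓ - 1) / 2 := by
  change HasBalancedDecomposition ℓ
  obtain ⟨k, rfl⟩ := hodd
  rcases Nat.lt_or_ge k 8 with hk | hk
  · have hk3 : 3 ≤ k := by omega
    interval_cases k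
    · exact hasBalancedDecomposition_seven
    · exact hasBalancedDecomposition_nine
    · exact hasBalancedDecomposition_eleven
    · exact hasBalancedDecomposition_thirteen
    · exact hasBalancedDecomposition_fifteen
  · rcases Nat.even_or_odd' k with ⟨m, rfl | rfl⟩
    · exact hasBalancedDecomposition_four_mul_add_one (by omega)
    · exact hasBalancedDecomposition_four_mul_add_three (by omega)
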